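/- A partition $\tau=(\tau_1\ge\tau_2\ge\dots\ge\tau_k\ge1)$ (possibly empty) is identified with its Ferrers diagram $\{(a,b)\in\mathbb{Z}_{\ge1}^2 : 1\le b\le k,\ 1\le a\le\tau_b\}$; its width is $\tau_1$ and its height is $k$ (both $0$ for the empty partition). It is called triangular if there are real numbers $r,s>0$ such that its Ferrers diagram is $\{(a,b)\in\mathbb{Z}_{\ge1}^2 : a/r+b/s\le 1\}$. Let $\Delta^{h\times\ell}$ be the set of triangular partitions of height at most $h$ and width at most $\ell$; for a triangular partition $\tau$, let $\mathbb{I}(\tau)$ be the number of triangular partitions whose Ferrers diagram is contained in that of $\tau$; let $\sigma^\ell=(\ell,\ell-1,\dots,2,1)$ be the staircase partition, and let $\varphi$ be Euler's totient function. For every integer $\ell\ge2$, the partition $\sigma^\ell\setminus\{(\ell,1)\}$ (the staircase with the last cell of its first row removed) is triangular, and $$ \left|\Delta^{\ell\times(\ell-1)}\right|=\mathbb{I}\bigl(\sigma^\ell\setminus\{(\ell,1)\}\bigr)=\frac12+\frac12\sum_{i=1}^{\ell}(\ell-i+1)^2\,\varphi(i). $$ -/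

import Mathlib

/-!
Partitions are Mathlib's Young diagrams: the cell `(a, b)` of the Ferrers diagram (column `a`,
row `b`, both counted from 1) is the pair `(b - 1, a - 1)`, i.e. the pair `(i, j)` below stands for
the lattice point `(j + 1, i + 1)`.  The part `τ_b` is `τ.rowLen (b - 1)`, and containment of
diagrams is `≤`.
-/

namespace TriangularPartition

/-- A partition is triangular if, for some positive reals `r` and `s`, its Ferrers diagram consists
of exactly the points of `{1, 2, …}²` on or below the line `x / r + y / s = 1`. -/
def IsTriangular (τ : YoungDiagram) : Prop :=
  ∃ r s : ℝ, 0 < r ∧ 0 < s ∧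
    ∀ i j : ℕ, (i, j) ∈ τ ↔ ((j : ℝ) + 1) / r + ((i : ℝ) + 1) / s ≤ 1

/-- The width of a partition: its largest part `τ_1`. -/
def width (τ : YoungDiagram) : ℕ := τ.rowLen 0

/-- The height of a partition: its number of parts. -/
def height (τ : YoungDiagram) : ℕ := τ.colLen 0

/-- `Δ^{h × l}`: the triangular partitions of height at most `h` and width at most `l`. -/
def inRectangle (h l : ℕ) : Set YoungDiagram :=
  {τ | IsTriangular τ ∧ height τ ≤ h ∧ width τ ≤ l}

/-- `I(τ)`: the number of triangular partitions contained in `τ`. -/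
noncomputable def numSub (τ : YoungDiagram) : ℕ :=
  {ν : YoungDiagram | IsTriangular ν ∧ ν ≤ τ}.ncard

/-- The staircase partition `σ^k = (k, k - 1, …, 2, 1)`. -/
def staircase (k : ℕ) : YoungDiagram where
  cells := (Finset.range k ×ˢ Finset.range k).filter fun c => c.1 + c.2 < k
  isLowerSet := by
    rintro ⟨i, j⟩ ⟨i', j'⟩ ⟨h₁, h₂⟩ h
    simp only [Finset.coe_filter, Finset.mem_product, Finset.mem_range, Set.mem_ofPred_eq] at h ⊢
    simp only at h₁ h₂
    omega

/-- `σ^k ∖ {(k, 1)}`: the staircase without the last cell of its first row. -/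
def staircaseErase (k : ℕ) : YoungDiagram where
  cells := (staircase k).cells.erase (0, k - 1)
  isLowerSet := by
    rintro ⟨i, j⟩ ⟨i', j'⟩ ⟨h₁, h₂⟩ h
    simp only [staircase, Finset.coe_erase, Finset.coe_filter, Finset.mem_product,
      Finset.mem_range, Set.mem_sdiff, Set.mem_ofPred_eq, Set.mem_singleton_iff,
      Prod.mk.injEq] at h ⊢
    simp only at h₁ h₂
    omega

end TriangularPartition

/-! ### Model diagrams and their triangularity -/

namespace TriangularPartition

/-! A triangular diagram with at least two rows has a canonical description. Among the pairs of a
cell and a non-cell below and to the right of it, one has maximal slope `q / p`. For coprime `p`,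
`q` the pair can be taken to be consecutive lattice points `(q + b, a)`, `(b, a + p)` of a line. The
diagram is then `cut p q a b` (`exists_eq_cut`), and the parameters are unique (`cut_injective`).

For a cut, fitting in the rectangle amounts to two linear inequalities, of which only the width
matters if `q ≤ p` and only the height if `p < q`. Write `n`, `k` for the larger and smaller of `p`,
`q`, and `t` for the slack. The numbers of cuts are `⌊kt/n⌋ + 1` and `⌈kt/n⌉` respectively. Since
`⌊kt/n⌋ + ⌈(n-k)t/n⌉ = t`, the symmetry `k ↦ n - k` of the units turns twice the count for `n ≥ 2`
into `φ(n) ((l-n+1)² - [n ∣ l])`. The corrections are summed by `∑_{d ∣ l} φ(d) = l`; together with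
`n = 1` and the `l` diagrams with at most one row they leave the constant `1`.

The count also equals that of subdiagrams of the erased staircase, because the points beyond a line
form a convex set (`inRectangle_eq`). -/

/-- The diagram of the cells `(i, j)` for which `(q * j + p * i, j)` is lexicographically at most
its value at `(q + b, a)`. -/
def cut (p q a b : ℕ) : YoungDiagram where
  cells := (Finset.range (q * a + p * (q + b) + 1) ×ˢ
    Finset.range (q * a + p * (q + b) + 1)).filter fun c =>
      q * c.2 + p * c.1 < q * a + p * (q + b) ∨
        q * c.2 + p * c.1 = q * a + p * (q + b) ∧ c.2 ≤ a
  isLowerSet := by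
    rintro ⟨i, j⟩ ⟨i', j'⟩ ⟨h₁, h₂⟩ h
    simp only [Finset.coe_filter, Finset.mem_product, Finset.mem_range, Set.mem_ofPred_eq] at h ⊢
    simp only at h₁ h₂
    have e₁ := Nat.mul_le_mul_left p h₁
    have e₂ := Nat.mul_le_mul_left q h₂
    omega

theorem mem_cut {p q a b i j : ℕ} (hp : 0 < p) (hq : 0 < q) :
    (i, j) ∈ cut p q a b ↔ q * j + p * i < q * a + p * (q + b) ∨
        q * j + p * i = q * a + p * (q + b) ∧ j ≤ a := by
  rw [← YoungDiagram.mem_cells]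
  simp only [cut, Finset.mem_filter, Finset.mem_product, Finset.mem_range, and_iff_right_iff_imp]
  intro h
  have e₁ := Nat.le_mul_of_pos_left i hp
  have e₂ := Nat.le_mul_of_pos_left j hq
  omega

/-- The one-row diagram of width `k`. -/
def row (k : ℕ) : YoungDiagram where
  cells := {0} ×ˢ Finset.range k
  isLowerSet := by
    rintro ⟨i, j⟩ ⟨i', j'⟩ ⟨h₁, h₂⟩ h
    simp only [Finset.mem_coe, Finset.mem_product, Finset.mem_range, Finset.mem_singleton] at h ⊢
    simp only at h₁ h₂
    omega

theorem mem_row {k i j : ℕ} : (i, j) ∈ row k ↔ i = 0 ∧ j < k := by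
  rw [← YoungDiagram.mem_cells]
  simp [row, and_comm, eq_comm]

theorem mem_staircaseErase {l i j : ℕ} :
    (i, j) ∈ staircaseErase l ↔ i + j < l ∧ ¬(i = 0 ∧ j = l - 1) := by
  rw [← YoungDiagram.mem_cells]
  simp only [staircaseErase, staircase, Finset.mem_erase, Finset.mem_filter, Finset.mem_product,
    Finset.mem_range, ne_eq, Prod.mk.injEq]
  omega

theorem isTriangular_row (k : ℕ) : IsTriangular (row k) := by
  refine ⟨2 * k + 1, 2, by positivity, by norm_num, fun i j => ?_⟩
  rw [mem_row]
  have hk : (0 : ℝ) < 2 * k + 1 := by positivity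
  constructor
  · rintro ⟨rfl, hj⟩
    have hj' : (j : ℝ) + 1 ≤ k := by exact_mod_cast hj
    have : ((j : ℝ) + 1) / (2 * k + 1) ≤ 1 / 2 := by
      rw [div_le_iff₀ hk]; linarith
    push_cast
    linarith
  · intro h
    have hpos : 0 < ((j : ℝ) + 1) / (2 * k + 1) := by positivity
    have hi : i = 0 := by
      by_contra hi
      have : (1 : ℝ) ≤ i := by exact_mod_cast Nat.one_le_iff_ne_zero.mpr hi
      linarith
    subst hi
    refine ⟨rfl, ?_⟩
    by_contra hj
    have hj' : (k : ℝ) ≤ j := by exact_mod_cast not_lt.mp hj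
    have : 1 / 2 < ((j : ℝ) + 1) / (2 * k + 1) := by
      rw [lt_div_iff₀ hk]; linarith
    push_cast at h
    linarith

/-- A diagram cut out by a linear inequality with positive integer weights is triangular. -/
theorem isTriangular_of_weights {τ : YoungDiagram} {u v C : ℕ} (hu : 0 < u) (hv : 0 < v)
    (h : ∀ i j, (i, j) ∈ τ ↔ (j + 1) * u + (i + 1) * v ≤ C) (hC : 0 < C) : IsTriangular τ := by
  have hu' : (0 : ℝ) < u := by exact_mod_cast hu
  have hv' : (0 : ℝ) < v := by exact_mod_cast hv
  have hC' : (0 : ℝ) < C := by exact_mod_cast hC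
  refine ⟨C / u, C / v, by positivity, by positivity, fun i j => ?_⟩
  rw [h, div_div_eq_mul_div, div_div_eq_mul_div, ← add_div, div_le_one hC']
  exact_mod_cast Iff.rfl

theorem isTriangular_cut {p q : ℕ} (hp : 0 < p) (hq : 0 < q) (a b : ℕ) :
    IsTriangular (cut p q a b) := by
  obtain ⟨c, hc⟩ : ∃ c, c = q * a + p * (q + b) := ⟨_, rfl⟩
  have ha : a ≤ c := by
    have := Nat.le_mul_of_pos_left a hq
    omega
  -- The lexicographic order becomes linear after scaling by `c + 1` and adding the column: columns
  -- of points with value at most `c` are at most `c`, so the perturbation only breaks ties.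
  refine isTriangular_of_weights (u := (c + 1) * q + 1) (v := (c + 1) * p)
    (C := (a + 1) * ((c + 1) * q + 1) + (q + b + 1) * ((c + 1) * p))
    (by positivity) (by positivity) (fun i j => ?_) (by positivity)
  rw [mem_cut hp hq, ← hc]
  have e : ∀ x y : ℕ, (x + 1) * ((c + 1) * q + 1) + (y + 1) * ((c + 1) * p) =
      (c + 1) * (q * x + p * y) + x + ((c + 1) * q + 1 + (c + 1) * p) := by intros; ring
  rw [e, e, ← hc, add_le_add_iff_right]
  have hj := Nat.le_mul_of_pos_left j hq
  rcases lt_trichotomy (q * j + p * i) c with h | h | h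
  · have := Nat.mul_le_mul_left (c + 1) (Nat.succ_le_of_lt h)
    rw [Nat.succ_eq_add_one, Nat.mul_succ] at this
    simp only [h, true_or, true_iff]
    omega
  · rw [h]
    omega
  · have := Nat.mul_le_mul_left (c + 1) (Nat.succ_le_of_lt h)
    rw [Nat.succ_eq_add_one, Nat.mul_succ] at this
    omega

theorem isTriangular_staircaseErase {l : ℕ} (hl : 2 ≤ l) : IsTriangular (staircaseErase l) := by
  have : staircaseErase l = cut 1 1 (l - 2) 0 := by
    ext ⟨i, j⟩
    rw [YoungDiagram.mem_cells, YoungDiagram.mem_cells, mem_staircaseErase,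
      mem_cut one_pos one_pos]
    omega
  rw [this]
  exact isTriangular_cut one_pos one_pos _ _

/-! ### The rectangle and the erased staircase -/

theorem height_le_iff {τ : YoungDiagram} {h : ℕ} : height τ ≤ h ↔ (h, 0) ∉ τ := by
  rw [YoungDiagram.mem_iff_lt_colLen, not_lt, height]

theorem width_le_iff {τ : YoungDiagram} {l : ℕ} : width τ ≤ l ↔ (0, l) ∉ τ := by
  rw [YoungDiagram.mem_iff_lt_rowLen, not_lt, width]

/-- A triangular diagram is described by a linear inequality with positive weights. -/
theorem IsTriangular.exists_weights {τ : YoungDiagram} (h : IsTriangular τ) :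
    ∃ u v : ℝ, 0 < u ∧ 0 < v ∧
      ∀ i j : ℕ, (i, j) ∈ τ ↔ ((j : ℝ) + 1) * u + ((i : ℝ) + 1) * v ≤ 1 := by
  obtain ⟨r, s, hr, hs, h⟩ := h
  exact ⟨r⁻¹, s⁻¹, inv_pos.mpr hr, inv_pos.mpr hs, by simpa only [div_eq_mul_inv] using h⟩

theorem inRectangle_eq {l : ℕ} (hl : 2 ≤ l) :
    inRectangle l (l - 1) = {ν | IsTriangular ν ∧ ν ≤ staircaseErase l} := by
  ext ν
  simp only [inRectangle, Set.mem_ofPred_eq, height_le_iff, width_le_iff]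
  refine and_congr_right fun hν => ⟨fun ⟨h₁, h₂⟩ => ?_, fun h => ⟨fun h' => ?_, fun h' => ?_⟩⟩
  · obtain ⟨u, v, hu, hv, H⟩ := hν.exists_weights
    rintro ⟨i, j⟩ hij
    change (i, j) ∈ ν at hij
    rw [mem_staircaseErase]
    refine ⟨?_, fun h => h₂ (by rw [← h.2, ← h.1]; exact hij)⟩
    by_contra! hlt
    have hi : i < l := by
      by_contra! hi
      exact h₁ (ν.up_left_mem hi (Nat.zero_le j) hij)
    rw [H] at h₁ h₂ hij
    push Not at h₁ h₂
    have hl1 : ((l - 1 : ℕ) : ℝ) = l - 1 := by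
      rw [Nat.cast_sub (by omega)]; simp
    rw [hl1] at h₂
    have hlt' : (l : ℝ) ≤ i + j := by exact_mod_cast hlt
    have hi' : (i : ℝ) < l := by exact_mod_cast hi
    have hi0 : (0 : ℝ) ≤ i := by positivity
    push_cast at h₁ h₂
    -- Average the non-cells `(0, l - 1)` and `(l, 0)` with weights `l - i` and `i`: the resulting
    -- point of row `i` lies beyond the line, yet has column less than `j`.
    have e₁ := mul_lt_mul_of_pos_left h₂ (sub_pos.mpr hi')
    have e₂ := mul_le_mul_of_nonneg_left h₁.le hi0
    have e₃ := mul_le_mul_of_nonneg_left hij (hi0.trans hi'.le)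
    have e₄ : 0 ≤ (l : ℝ) * u * (i + j - l) := by
      have : (0 : ℝ) ≤ i + j - l := by linarith
      positivity
    have e₅ : 0 ≤ u * ((l : ℝ) - i) := mul_nonneg hu.le (by linarith)
    linarith
  · have := mem_staircaseErase.mp (h h')
    omega
  · have := mem_staircaseErase.mp (h h')
    omega

/-! ### Uniqueness of the canonical cut -/

theorem cut_injective {p q a b p' q' a' b' : ℕ} (hp : 0 < p) (hq : 0 < q) (hp' : 0 < p')
    (hq' : 0 < q') (hpq : p.Coprime q) (hpq' : p'.Coprime q')
    (h : cut p q a b = cut p' q' a' b') : p = p' ∧ q = q' ∧ a = a' ∧ b = b' := by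
  have key : ∀ {p q a b p' q' a' b' : ℕ}, 0 < p → 0 < q → 0 < p' → 0 < q' →
      cut p q a b = cut p' q' a' b' → p * q' ≤ q * p' := by
    intro p q a b p' q' a' b' hp hq hp' hq' h
    by_contra! hlt
    -- If `q / p` were smaller than `q' / p'`, the form `q * j + p * i` would drop from this cell to
    -- the non-cell `(b', a' + p')`, making the latter a cell.
    have hP : (q' + b', a') ∈ cut p q a b := by
      rw [h, mem_cut hp' hq']; exact Or.inr ⟨rfl, le_rfl⟩
    have hQ : (b', a' + p') ∉ cut p q a b := by
      rw [h, mem_cut hp' hq']; push Not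
      refine ⟨le_of_eq (by ring), fun _ => by omega⟩
    rw [mem_cut hp hq] at hP hQ
    refine hQ (Or.inl ?_)
    have : q * a' + p * (q' + b') ≤ q * a + p * (q + b) := by omega
    linarith
  have e₁ := key hp hq hp' hq' h
  have e₂ := key hp' hq' hp hq h.symm
  have e : p * q' = p' * q := by linarith
  have hpp : p = p' := Nat.dvd_antisymm
    (hpq.dvd_of_dvd_mul_right (Dvd.intro _ e)) (hpq'.dvd_of_dvd_mul_right (Dvd.intro _ e.symm))
  subst hpp
  have hqq : q = q' := (Nat.eq_of_mul_eq_mul_left hp e).symm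
  subst hqq
  have hP : (q + b', a') ∈ cut p q a b := by
    rw [h, mem_cut hp hq]; exact Or.inr ⟨rfl, le_rfl⟩
  have hP' : (q + b, a) ∈ cut p q a' b' := by
    rw [← h, mem_cut hp hq]; exact Or.inr ⟨rfl, le_rfl⟩
  rw [mem_cut hp hq] at hP hP'
  have ha : a = a' := by omega
  subst ha
  have : p * (q + b) = p * (q + b') := by omega
  have := Nat.eq_of_mul_eq_mul_left hp this
  exact ⟨rfl, rfl, rfl, by omega⟩

/-! ### Existence of the canonical cut -/

/-- A triangular diagram has a pair of a cell and a non-cell below and to the right of it whose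
slope is maximal, as soon as it has at least two rows. -/
theorem exists_max_slope {ν : YoungDiagram} (h : (1, 0) ∈ ν) :
    ∃ p q a b : ℕ, 0 < p ∧ 0 < q ∧ (q + b, a) ∈ ν ∧ (b, a + p) ∉ ν ∧
      ∀ i j i' j' : ℕ, (i, j) ∈ ν → (i', j') ∉ ν → j < j' → q * j + p * i ≤ q * j' + p * i' := by
  set W := ν.rowLen 0 with hW
  have hlt : ∀ {i j}, (i, j) ∈ ν → j < W := fun {i j} hij =>
    YoungDiagram.mem_iff_lt_rowLen.mp (ν.up_left_mem (Nat.zero_le i) le_rfl hij)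
  have hWn : ∀ i, (i, W) ∉ ν := fun i hi => (hlt hi).ne rfl
  set S := (ν.cells ×ˢ (Finset.range (ν.colLen 0) ×ˢ Finset.range (W + 1))).filter
    fun c => c.2 ∉ ν ∧ c.1.2 < c.2.2 ∧ c.2.1 < c.1.1 with hS
  have hmem : ∀ {i j i' j' : ℕ}, (i, j) ∈ ν → (i', j') ∉ ν → j < j' → i' < i → j' ≤ W →
      ((i, j), (i', j')) ∈ S := by
    intro i j i' j' h₁ h₂ h₃ h₄ h₅
    have : i < ν.colLen 0 :=
      YoungDiagram.mem_iff_lt_colLen.mp (ν.up_left_mem le_rfl (Nat.zero_le j) h₁)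
    simp only [hS, Finset.mem_filter, Finset.mem_product, YoungDiagram.mem_cells, Finset.mem_range]
    exact ⟨⟨h₁, by omega, by omega⟩, h₂, h₃, h₄⟩
  obtain ⟨⟨⟨i₀, j₀⟩, ⟨i₁, j₁⟩⟩, h₀, hmax⟩ := S.exists_max_image
    (fun c => ((c.1.1 : ℚ) - c.2.1) / ((c.2.2 : ℚ) - c.1.2))
    ⟨((1, 0), (0, W)), hmem h (hWn 0) (hlt h) one_pos le_rfl⟩
  simp only [hS, Finset.mem_filter, Finset.mem_product, YoungDiagram.mem_cells,
    Finset.mem_range] at h₀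
  obtain ⟨⟨hP, -, -⟩, hQ, hj, hi⟩ := h₀
  obtain ⟨q, rfl⟩ := Nat.exists_eq_add_of_lt hi
  obtain ⟨p, rfl⟩ := Nat.exists_eq_add_of_lt hj
  refine ⟨p + 1, q + 1, j₀, i₁, by omega, by omega, ?_, hQ, ?_⟩
  · rwa [show q + 1 + i₁ = i₁ + q + 1 by ring]
  intro i j i' j' hA hB hjj
  rcases le_or_gt i i' with hii | hii
  · exact add_le_add (Nat.mul_le_mul_left _ hjj.le) (Nat.mul_le_mul_left _ hii)
  -- Moving a non-cell left to column `W` only increases the slope, so finitely many pairs suffice.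
  have hB' : (i', min j' W) ∉ ν := by
    rcases min_choice j' W with h | h <;> rw [h]
    · exact hB
    · exact hWn _
  have hjm : j < min j' W := lt_min hjj (hlt hA)
  have hle := hmax _ (hmem hA hB' hjm hii (min_le_right _ _))
  have hjq : (0 : ℚ) < ((min j' W : ℕ) : ℚ) - j := sub_pos.mpr (by exact_mod_cast hjm)
  simp only at hle
  rw [div_le_div_iff₀ hjq (sub_pos.mpr (by exact_mod_cast hj))] at hle
  push_cast [-Nat.cast_min] at hle
  have hle' : (q + 1) * j + (p + 1) * i ≤ (q + 1) * min j' W + (p + 1) * i' := by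
    have : ((q : ℚ) + 1) * j + (p + 1) * i ≤ (q + 1) * (min j' W : ℕ) + (p + 1) * i' := by
      linarith
    exact_mod_cast this
  exact hle'.trans (Nat.add_le_add_right (Nat.mul_le_mul_left _ (min_le_left _ _)) _)

/-- The maximal slope of `exists_max_slope` is attained with coprime `p` and `q`. -/
theorem exists_max_slope_coprime {ν : YoungDiagram} (h : (1, 0) ∈ ν) :
    ∃ p q a b : ℕ, 0 < p ∧ 0 < q ∧ p.Coprime q ∧ (q + b, a) ∈ ν ∧ (b, a + p) ∉ ν ∧
      ∀ i j i' j' : ℕ, (i, j) ∈ ν → (i', j') ∉ ν → j < j' → q * j + p * i ≤ q * j' + p * i' := by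
  obtain ⟨p, q, a, b, hp, hq, hP, hQ, H⟩ := exists_max_slope h
  obtain ⟨g, p', q', hg, hco, rfl, rfl⟩ := Nat.exists_coprime' (Nat.gcd_pos_of_pos_left q hp)
  have hp' : 0 < p' := Nat.pos_of_mul_pos_right hp
  have hq' : 0 < q' := Nat.pos_of_mul_pos_right hq
  -- The segment splits into `g` primitive steps from a cell to a non-cell; one of them leaves the
  -- diagram.
  have hstep : ∃ k < g, (q' * (g - k) + b, a + p' * k) ∈ ν ∧
      (q' * (g - (k + 1)) + b, a + p' * (k + 1)) ∉ ν := by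
    by_contra! hno
    have : ∀ k ≤ g, (q' * (g - k) + b, a + p' * k) ∈ ν := by
      intro k
      induction k with
      | zero => intro _; simpa using hP
      | succ k ih => intro hk; exact hno k hk (ih (by omega))
    apply hQ
    simpa using this g le_rfl
  obtain ⟨k, hk, h₁, h₂⟩ := hstep
  refine ⟨p', q', a + p' * k, q' * (g - (k + 1)) + b, hp', hq', hco, ?_, ?_, ?_⟩
  · have e : q' + (q' * (g - (k + 1)) + b) = q' * (g - k) + b := by
      rw [← add_assoc, add_comm q', ← Nat.mul_succ, show (g - (k + 1)).succ = g - k by omega]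
    rwa [e]
  · rwa [add_assoc, ← Nat.mul_succ]
  · intro i j i' j' hA hB hj
    have := H i j i' j' hA hB hj
    refine Nat.le_of_mul_le_mul_left (c := g) ?_ hg
    linarith

/-- Maximality puts every cell weakly before every non-cell for `q * j + p * i`. On a level line the
real weights increase with the column, which gives the tie-break. -/
theorem exists_eq_cut {ν : YoungDiagram} (hν : IsTriangular ν) (h : (1, 0) ∈ ν) :
    ∃ p q a b : ℕ, 0 < p ∧ 0 < q ∧ p.Coprime q ∧ ν = cut p q a b := by
  obtain ⟨p, q, a, b, hp, hq, hco, hP, hQ, H⟩ := exists_max_slope_coprime h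
  refine ⟨p, q, a, b, hp, hq, hco, ?_⟩
  obtain ⟨u, v, hu, hv, hw⟩ := hν.exists_weights
  have hp' : (0 : ℝ) < p := by exact_mod_cast hp
  have hq' : (0 : ℝ) < q := by exact_mod_cast hq
  have hslope : v * q < u * p := by
    have h₁ := (hw _ _).mp hP
    have h₂ := not_le.mp (mt (hw _ _).mpr hQ)
    push_cast at h₁ h₂
    linarith
  have hle : ∀ i j i' j' : ℕ, (i, j) ∈ ν → (i', j') ∉ ν → q * j + p * i ≤ q * j' + p * i' := by
    intro i j i' j' hA hB
    rcases lt_or_ge j j' with hj | hj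
    · exact H i j i' j' hA hB hj
    have h₁ := (hw _ _).mp hA
    have h₂ := not_le.mp (mt (hw _ _).mpr hB)
    have hj' : (0 : ℝ) ≤ j - j' := sub_nonneg.mpr (by exact_mod_cast hj)
    have e₁ := mul_le_mul_of_nonneg_right hslope.le hj'
    have e₂ : v * (q * ((j : ℝ) - j')) ≤ v * (p * ((i' : ℝ) - i)) := by
      have := mul_lt_mul_of_pos_left (h₁.trans_lt h₂) hp'
      linarith
    have e₃ := le_of_mul_le_mul_left e₂ hv
    have : (q : ℝ) * j + p * i ≤ q * j' + p * i' := by linarith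
    exact_mod_cast this
  have hline : ∀ i j i' j' : ℕ, q * j + p * i = q * j' + p * i' → j ≤ j' → (i', j') ∈ ν →
      (i, j) ∈ ν := by
    intro i j i' j' he hj hmem
    rw [hw] at hmem ⊢
    have he' : (q : ℝ) * j + p * i = q * j' + p * i' := by exact_mod_cast he
    have hj' : (0 : ℝ) ≤ j' - j := sub_nonneg.mpr (by exact_mod_cast hj)
    have e₁ := mul_le_mul_of_nonneg_right hslope.le hj'
    have e₂ : p * (((j : ℝ) + 1) * u + (i + 1) * v) ≤ p * (((j' : ℝ) + 1) * u + (i' + 1) * v) := by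
      have : v * ((q : ℝ) * j + p * i) = v * (q * j' + p * i') := by rw [he']
      linarith
    exact (le_of_mul_le_mul_left e₂ hp').trans hmem
  have hfQ : q * (a + p) + p * b = q * a + p * (q + b) := by ring
  ext ⟨i, j⟩
  rw [YoungDiagram.mem_cells, YoungDiagram.mem_cells, mem_cut hp hq]
  constructor
  · intro hR
    have h₁ := hle _ _ _ _ hR hQ
    rw [hfQ] at h₁
    refine h₁.lt_or_eq.imp_right fun he => ⟨he, ?_⟩
    by_contra! hj
    -- Lattice points on this line have columns differing by multiples of `p`, so the first one past
    -- column `a` is the non-cell `(b, a + p)`.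
    have hdvd : p ∣ j - a := by
      have hi : i ≤ q + b := by
        by_contra! hi
        have e₁ := Nat.mul_le_mul_left q hj.le
        have e₂ := Nat.mul_lt_mul_of_pos_left hi hp
        omega
      refine hco.dvd_of_dvd_mul_left ⟨q + b - i, ?_⟩
      rw [Nat.mul_sub, Nat.mul_sub]
      have := Nat.mul_le_mul_left p hi
      have := Nat.mul_le_mul_left q hj.le
      omega
    have hpj := Nat.le_of_dvd (by omega) hdvd
    exact hQ (hline _ _ _ _ (by rw [hfQ, he]) (by omega) hR)
  · rintro (h | ⟨he, hj⟩)
    · by_contra hR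
      have := hle _ _ _ _ hP hR
      omega
    · exact hline _ _ _ _ he hj hP

theorem eq_row {ν : YoungDiagram} (h : (1, 0) ∉ ν) : ν = row (ν.rowLen 0) := by
  ext ⟨i, j⟩
  rw [YoungDiagram.mem_cells, YoungDiagram.mem_cells, mem_row]
  constructor
  · intro hij
    have : i = 0 := by
      by_contra hi
      exact h (ν.up_left_mem (Nat.one_le_iff_ne_zero.mpr hi) (Nat.zero_le j) hij)
    subst this
    exact ⟨rfl, YoungDiagram.mem_iff_lt_rowLen.mp hij⟩
  · rintro ⟨rfl, hj⟩
    exact YoungDiagram.mem_iff_lt_rowLen.mpr hj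

/-! ### Floor and ceiling sums over units -/

/-- The numbers in `[1, n]` that are coprime to `n`. -/
def units (n : ℕ) : Finset ℕ := (Finset.Icc 1 n).filter fun k => n.Coprime k

theorem card_units (n : ℕ) : (units n).card = n.totient := by
  have h : Finset.Icc 1 n = Finset.Ico 1 (1 + n) := by
    ext; simp only [Finset.mem_Icc, Finset.mem_Ico]; omega
  rw [units, h, Nat.filter_coprime_Ico_eq_totient]

theorem mem_units {n k : ℕ} : k ∈ units n ↔ (1 ≤ k ∧ k ≤ n) ∧ n.Coprime k := by
  simp [units]

theorem lt_of_mem_units {n k : ℕ} (hn : 2 ≤ n) (h : k ∈ units n) : k < n := by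
  rw [mem_units] at h
  refine lt_of_le_of_ne h.1.2 fun e => ?_
  rw [e, Nat.coprime_self] at h
  omega

theorem sum_units_reflect {M : Type*} [AddCommMonoid M] {n : ℕ} (hn : 2 ≤ n) (g : ℕ → M) :
    ∑ k ∈ units n, g (n - k) = ∑ k ∈ units n, g k := by
  have h : ∀ k ∈ units n, n - k ∈ units n := by
    intro k hk
    have := lt_of_mem_units hn hk
    rw [mem_units] at hk ⊢
    exact ⟨by omega, (Nat.coprime_self_sub_right hk.1.2).mpr hk.2⟩
  refine Finset.sum_nbij' (n - ·) (n - ·) h h ?_ ?_ fun _ _ => rfl <;>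
  · intro k hk
    have := lt_of_mem_units hn hk
    omega

theorem floor_add_ceil {n k : ℕ} (hk : k < n) (t : ℕ) :
    k * t / n + ((n - k) * t + (n - 1)) / n = t := by
  have h₁ := Nat.div_add_mod (k * t) n
  have h₂ := Nat.mod_lt (k * t) (show 0 < n by omega)
  generalize k * t / n = d at h₁ ⊢
  generalize k * t % n = r at h₁ h₂
  have hd : d ≤ t := by
    have : n * d ≤ n * t := by
      have := Nat.mul_le_mul_right t hk.le
      omega
    exact Nat.le_of_mul_le_mul_left this (by omega)
  obtain ⟨e, rfl⟩ := Nat.exists_eq_add_of_le hd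
  have : ((n - k) * (d + e) + (n - 1)) / n = e := by
    have h₃ : n * (d + e) = (n - k) * (d + e) + k * (d + e) := by
      rw [← add_mul, Nat.sub_add_cancel (by omega)]
    rw [mul_add] at h₃
    rw [Nat.div_eq_iff (by omega)]
    have : e * n = n * e := mul_comm _ _
    omega
  rw [this]

theorem ceil_eq_floor_add {n : ℕ} (hn : 0 < n) (x : ℕ) :
    (x + (n - 1)) / n = x / n + if n ∣ x then 0 else 1 := by
  split_ifs with h
  · obtain ⟨y, rfl⟩ := h
    rw [add_zero, Nat.mul_add_div hn, Nat.div_eq_of_lt (by omega : n - 1 < n),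
      Nat.mul_div_cancel_left _ hn, add_zero]
  · have h₁ := Nat.div_add_mod x n
    have h₂ := Nat.mod_lt x hn
    have h₃ : 0 < x % n := Nat.pos_of_ne_zero fun e => h (Nat.dvd_of_mod_eq_zero e)
    rw [Nat.div_eq_iff hn]
    have : (x / n + 1) * n = n * (x / n) + n := by ring
    omega

/-- Pairing `k` with `n - k` gives `t`, plus one exactly when `k * t / n` is not an integer, i.e.
when `n ∤ t`. -/
theorem two_mul_sum_ceil {n : ℕ} (hn : 2 ≤ n) (t : ℕ) :
    2 * ∑ k ∈ units n, (k * t + (n - 1)) / n =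
      n.totient * (t + if n ∣ t then 0 else 1) := by
  rw [two_mul]
  nth_rewrite 1 [← sum_units_reflect hn]
  rw [← Finset.sum_add_distrib, ← card_units, ← smul_eq_mul, ← Finset.sum_const]
  refine Finset.sum_congr rfl fun k hk => ?_
  have h₁ := floor_add_ceil (lt_of_mem_units hn hk) t
  have h₂ := ceil_eq_floor_add (show 0 < n by omega) (k * t)
  simp only [(mem_units.mp hk).2.dvd_mul_left] at h₂
  omega

/-! ### Index sets and their cardinality -/

/-- The triangular diagrams given by `cut p q` with `q ≤ p = n`, encoded as `(n, q, t, b)`. -/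
def steepIndex (l : ℕ) : Finset (Σ _ : ℕ, Σ _ : ℕ, Σ _ : ℕ, ℕ) :=
  (Finset.Icc 1 l).sigma fun n => (units n).sigma fun k =>
    (Finset.range (l - n)).sigma fun t => Finset.range (k * t / n + 1)

/-- The triangular diagrams given by `cut p q` with `p < q = n`, encoded as `(n, p, t, a)`. -/
def flatIndex (l : ℕ) : Finset (Σ _ : ℕ, Σ _ : ℕ, Σ _ : ℕ, ℕ) :=
  (Finset.Icc 2 l).sigma fun n => (units n).sigma fun k =>
    (Finset.Icc 1 (l - n)).sigma fun t => Finset.range ((k * t + (n - 1)) / n)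

theorem card_steepIndex (l : ℕ) : (steepIndex l).card =
    ∑ n ∈ Finset.Icc 1 l, ∑ k ∈ units n, ∑ t ∈ Finset.range (l - n), (k * t / n + 1) := by
  simp [steepIndex, Finset.card_sigma]

theorem card_flatIndex (l : ℕ) : (flatIndex l).card =
    ∑ n ∈ Finset.Icc 2 l, ∑ k ∈ units n, ∑ t ∈ Finset.Icc 1 (l - n), (k * t + (n - 1)) / n := by
  simp [flatIndex, Finset.card_sigma]

theorem sum_Icc_one_eq {M : Type*} [AddCommMonoid M] (g : ℕ → M) (h : g 0 = 0) (m : ℕ) :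
    ∑ t ∈ Finset.Icc 1 m, g t = ∑ t ∈ Finset.range m, g t + g m := by
  induction m with
  | zero => simp [h]
  | succ m ih => rw [Finset.sum_Icc_succ_top (by omega), ih, Finset.sum_range_succ]

theorem two_mul_sum_range_succ (m : ℕ) : 2 * ∑ t ∈ Finset.range m, (t + 1) = m * (m + 1) := by
  have h₁ := Finset.sum_range_succ' (fun t => t) m
  have h₂ := Finset.sum_range_id_mul_two (m + 1)
  simp only [add_zero] at h₁
  rw [← h₁, mul_comm, h₂, Nat.add_sub_cancel, mul_comm]

/-- The terms with `t < l - n` pair up to `t + 1`; the unpaired ceilings at `t = l - n` produce the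
divisibility correction, as `n ∣ l - n` iff `n ∣ l`. -/
theorem two_mul_sum_floor_add_ceil {n l : ℕ} (hn : 2 ≤ n) (hl : n ≤ l) :
    2 * (∑ k ∈ units n, ∑ t ∈ Finset.range (l - n), (k * t / n + 1) +
      ∑ k ∈ units n, ∑ t ∈ Finset.Icc 1 (l - n), (k * t + (n - 1)) / n) +
        (if n ∣ l then n.totient else 0) = (l - n + 1) ^ 2 * n.totient := by
  obtain ⟨m, rfl⟩ := Nat.exists_eq_add_of_le hl
  simp only [Nat.add_sub_cancel_left, Nat.dvd_add_self_left]
  have hceil : ∀ k, ∑ t ∈ Finset.Icc 1 m, (k * t + (n - 1)) / n =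
      ∑ t ∈ Finset.range m, (k * t + (n - 1)) / n + (k * m + (n - 1)) / n := by
    intro k
    have h₀ : (k * 0 + (n - 1)) / n = 0 := by
      rw [mul_zero, zero_add, Nat.div_eq_of_lt (by omega)]
    exact sum_Icc_one_eq _ h₀ m
  have hmain : ∑ k ∈ units n, ∑ t ∈ Finset.range m, (k * t / n + 1) +
      ∑ k ∈ units n, ∑ t ∈ Finset.range m, (k * t + (n - 1)) / n =
      n.totient * ∑ t ∈ Finset.range m, (t + 1) := by
    rw [← sum_units_reflect hn fun k => ∑ t ∈ Finset.range m, (k * t + (n - 1)) / n,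
      ← Finset.sum_add_distrib, ← card_units, ← smul_eq_mul, ← Finset.sum_const]
    refine Finset.sum_congr rfl fun k hk => ?_
    rw [← Finset.sum_add_distrib]
    refine Finset.sum_congr rfl fun t _ => ?_
    have := floor_add_ceil (lt_of_mem_units hn hk) t
    omega
  simp only [hceil, Finset.sum_add_distrib (f := fun k => ∑ t ∈ Finset.range m, (k * t + (n - 1)) / n)]
  rw [← add_assoc, hmain, mul_add, two_mul_sum_ceil hn, mul_left_comm, two_mul_sum_range_succ]
  split_ifs <;> ring

theorem two_mul_card_index {l : ℕ} (hl : 1 ≤ l) :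
    2 * (l + (steepIndex l).card + (flatIndex l).card) =
      1 + ∑ n ∈ Finset.Icc 1 l, (l - n + 1) ^ 2 * n.totient := by
  have hins : Finset.Icc 1 l = insert 1 (Finset.Icc 2 l) :=
    (Finset.insert_Icc_add_one_left_eq_Icc hl).symm
  have h1 : (1 : ℕ) ∉ Finset.Icc 2 l := by simp
  have hdiv : ∑ n ∈ Finset.Icc 2 l, (if n ∣ l then n.totient else 0) = l - 1 := by
    have h := Nat.sum_totient l
    have hd : l.divisors = (Finset.Icc 1 l).filter (· ∣ l) := by
      ext; simp only [Nat.mem_divisors, Finset.mem_filter, Finset.mem_Icc]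
      exact ⟨fun h => ⟨⟨Nat.pos_of_dvd_of_pos h.1 hl, Nat.le_of_dvd hl h.1⟩, h.1⟩,
        fun h => ⟨h.2, by omega⟩⟩
    rw [hd, Finset.sum_filter, hins, Finset.sum_insert h1] at h
    simp at h
    omega
  have hu1 : units 1 = {1} := by decide
  have hsum := Finset.sum_congr rfl fun n (hn : n ∈ Finset.Icc 2 l) =>
    two_mul_sum_floor_add_ceil (Finset.mem_Icc.mp hn).1 (Finset.mem_Icc.mp hn).2
  rw [Finset.sum_add_distrib, ← Finset.mul_sum, Finset.sum_add_distrib, hdiv] at hsum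
  rw [card_steepIndex, card_flatIndex, hins, Finset.sum_insert h1, Finset.sum_insert h1, ← hsum,
    hu1]
  obtain ⟨m, rfl⟩ := Nat.exists_eq_add_of_le' hl
  simp only [Finset.sum_singleton, Nat.add_sub_cancel, one_mul, Nat.div_one, Nat.totient_one]
  have hgauss := two_mul_sum_range_succ m
  have : (m + 1) ^ 2 = m * (m + 1) + m + 1 := by ring
  omega

/-! ### Enumerating the diagrams in the rectangle -/

/-- The diagram encoded by an element of `steepIndex l`. -/
def steepDiagram (l : ℕ) (c : Σ _ : ℕ, Σ _ : ℕ, Σ _ : ℕ, ℕ) : YoungDiagram :=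
  cut c.1 c.2.1 (l - 1 - c.1 - c.2.2.1) c.2.2.2

/-- The diagram encoded by an element of `flatIndex l`. -/
def flatDiagram (l : ℕ) (c : Σ _ : ℕ, Σ _ : ℕ, Σ _ : ℕ, ℕ) : YoungDiagram :=
  cut c.2.1 c.1 c.2.2.2 (l - c.1 - c.2.2.1)

theorem cut_mem_inRectangle {p q : ℕ} (hp : 0 < p) (hq : 0 < q) (a b h w : ℕ) :
    cut p q a b ∈ inRectangle h w ↔
      q * a + p * (q + b) < p * h ∧ q * a + p * (q + b) ≤ q * w := by
  simp only [inRectangle, Set.mem_ofPred_eq, isTriangular_cut hp hq, height_le_iff, width_le_iff,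
    mem_cut hp hq, true_and, mul_zero, zero_add, add_zero]
  -- A tie at `(0, w)` always falls outside the cut, whereas a tie at `(h, 0)` falls inside; hence
  -- one weak and one strict inequality.
  have : q * w = q * a + p * (q + b) → a < w := by
    intro e
    have : 0 < p * (q + b) := by positivity
    exact Nat.lt_of_mul_lt_mul_left (a := q) (by omega)
  omega

theorem row_mem_inRectangle {k h w : ℕ} (hh : 0 < h) : row k ∈ inRectangle h w ↔ k ≤ w := by
  simp only [inRectangle, Set.mem_ofPred_eq, isTriangular_row, height_le_iff, width_le_iff,
    mem_row, true_and]
  omega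

theorem mem_steepIndex {l n k t b : ℕ} : ⟨n, k, t, b⟩ ∈ steepIndex l ↔
    (1 ≤ n ∧ n ≤ l) ∧ k ∈ units n ∧ t < l - n ∧ n * b ≤ k * t := by
  simp only [steepIndex, Finset.mem_sigma, Finset.mem_Icc, Finset.mem_range, Nat.lt_succ_iff]
  refine and_congr_right fun h => ?_
  rw [Nat.le_div_iff_mul_le h.1, mul_comm b]

theorem mem_flatIndex {l n k t a : ℕ} : ⟨n, k, t, a⟩ ∈ flatIndex l ↔
    (2 ≤ n ∧ n ≤ l) ∧ k ∈ units n ∧ (1 ≤ t ∧ t ≤ l - n) ∧ n * a < k * t := by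
  simp only [flatIndex, Finset.mem_sigma, Finset.mem_Icc, Finset.mem_range]
  refine and_congr_right fun h => and_congr_right fun _ => and_congr_right fun _ => ?_
  rw [← Nat.succ_le_iff (m := a), Nat.succ_eq_add_one, Nat.le_div_iff_mul_le (by omega), add_mul, mul_comm a]
  omega

open Classical in
theorem inRectangle_eq_union {l : ℕ} (hl : 2 ≤ l) : inRectangle l (l - 1) =
    ((Finset.range l).image row ∪ ((steepIndex l).image (steepDiagram l) ∪
      (flatIndex l).image (flatDiagram l)) : Finset YoungDiagram) := by
  ext ν
  simp only [Finset.coe_union, Finset.coe_image, Set.mem_union, Set.mem_image, Finset.mem_coe,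
    Finset.mem_range]
  constructor
  · intro hν
    by_cases h : (1, 0) ∈ ν
    · right
      obtain ⟨p, q, a, b, hp, hq, hco, rfl⟩ := exists_eq_cut hν.1 h
      rw [cut_mem_inRectangle hp hq] at hν
      obtain ⟨h₁, h₂⟩ := hν
      rcases le_or_gt q p with hqp | hpq
      · left
        have hpa : p + a ≤ l - 1 := by
          refine Nat.le_of_mul_le_mul_left (c := q) ?_ hq
          linarith [Nat.zero_le (p * b)]
        refine ⟨⟨p, q, l - 1 - p - a, b⟩, mem_steepIndex.mpr
          ⟨by omega, mem_units.mpr ⟨⟨hq, hqp⟩, hco⟩, by omega, ?_⟩, ?_⟩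
        · obtain ⟨t, ht⟩ := Nat.exists_eq_add_of_le hpa
          rw [ht] at h₂ ⊢
          rw [show p + a + t - p - a = t by omega]
          linarith
        · simp only [steepDiagram]
          congr 1
          omega
      · right
        have hqb : q + b < l := by
          refine Nat.lt_of_mul_lt_mul_left (a := p) ?_
          linarith [Nat.zero_le (q * a)]
        refine ⟨⟨q, p, l - q - b, a⟩, mem_flatIndex.mpr
          ⟨by omega, mem_units.mpr ⟨⟨hp, hpq.le⟩, hco.symm⟩, by omega, ?_⟩, ?_⟩
        · obtain ⟨t, rfl⟩ := Nat.exists_eq_add_of_le hqb.le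
          rw [show q + b + t - q - b = t by omega]
          linarith
        · simp only [flatDiagram]
          congr 1
          omega
    · left
      rw [eq_row h] at hν ⊢
      rw [row_mem_inRectangle (by omega)] at hν
      exact ⟨_, by omega, rfl⟩
  · rintro (⟨k, hk, rfl⟩ | ⟨⟨n, k, t, b⟩, hc, rfl⟩ | ⟨⟨n, k, t, a⟩, hc, rfl⟩)
    · rw [row_mem_inRectangle (by omega)]
      omega
    · obtain ⟨hn, hk, ht, hb⟩ := mem_steepIndex.mp hc
      have hk' := (mem_units.mp hk).1
      change cut n k (l - 1 - n - t) b ∈ _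
      rw [cut_mem_inRectangle (by omega) (by omega)]
      obtain ⟨a, ha⟩ := Nat.exists_eq_add_of_le (show n + t ≤ l - 1 by omega)
      obtain rfl : l = n + t + a + 1 := by omega
      rw [show n + t + a + 1 - 1 - n - t = a by omega, Nat.add_sub_cancel]
      -- With `k ≤ n` the width bound implies the height bound.
      have hle := Nat.mul_le_mul_right (t + a) hk'.2
      have hle' := Nat.mul_le_mul_right n hk'.2
      constructor <;> linarith
    · obtain ⟨hn, hk, ht, ha⟩ := mem_flatIndex.mp hc
      have hk' := (mem_units.mp hk).1
      have hlt := lt_of_mem_units hn.1 hk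
      change cut k n a (l - n - t) ∈ _
      rw [cut_mem_inRectangle (by omega) (by omega)]
      obtain ⟨b, rfl⟩ := Nat.exists_eq_add_of_le (show n + t ≤ l by omega)
      rw [show n + t + b - n - t = b by omega]
      have h₁ : n * a + k * (n + b) < k * (n + t + b) := by linarith
      refine ⟨h₁, h₁.le.trans ?_⟩
      obtain ⟨d, rfl⟩ := Nat.exists_eq_add_of_lt hlt
      obtain ⟨m, hm⟩ := Nat.exists_eq_add_of_le' (show 1 ≤ k + d + 1 + t + b by omega)
      have hkm : k ≤ m := by omega
      rw [hm, Nat.add_sub_cancel]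
      linarith [Nat.zero_le (d * m)]

theorem row_injective : Function.Injective row := by
  have key : ∀ {k k'}, row k = row k' → k ≤ k' := by
    intro k k' h
    by_contra! hlt
    have : (0, k') ∈ row k := mem_row.mpr ⟨rfl, hlt⟩
    rw [h, mem_row] at this
    omega
  exact fun k k' h => le_antisymm (key h) (key h.symm)

theorem row_ne_cut {k p q a b : ℕ} (hp : 0 < p) (hq : 0 < q) : row k ≠ cut p q a b := by
  intro h
  have : (q + b, a) ∈ row k := by
    rw [h, mem_cut hp hq]; exact Or.inr ⟨rfl, le_rfl⟩
  rw [mem_row] at this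
  omega

open Classical in
theorem ncard_inRectangle {l : ℕ} (hl : 2 ≤ l) :
    (inRectangle l (l - 1)).ncard = l + (steepIndex l).card + (flatIndex l).card := by
  rw [inRectangle_eq_union hl, Set.ncard_coe_finset, Finset.card_union_of_disjoint,
    Finset.card_union_of_disjoint, Finset.card_image_of_injective _ row_injective,
    Finset.card_image_of_injOn, Finset.card_image_of_injOn, Finset.card_range, add_assoc]
  · rintro ⟨n, k, t, a⟩ h ⟨n', k', t', a'⟩ h' e
    rw [Finset.mem_coe, mem_flatIndex, mem_units] at h h'
    obtain ⟨rfl, rfl, rfl, e⟩ := cut_injective (by omega) (by omega) (by omega) (by omega)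
      h.2.1.2.symm h'.2.1.2.symm e
    obtain rfl : t = t' := by simp only at e; omega
    rfl
  · rintro ⟨n, k, t, b⟩ h ⟨n', k', t', b'⟩ h' e
    rw [Finset.mem_coe, mem_steepIndex, mem_units] at h h'
    obtain ⟨rfl, rfl, e, rfl⟩ := cut_injective (by omega) (by omega) (by omega) (by omega)
      h.2.1.2 h'.2.1.2 e
    obtain rfl : t = t' := by simp only at e; omega
    rfl
  · rw [Finset.disjoint_left]
    intro ν h h'
    obtain ⟨⟨n, k, t, b⟩, hs, rfl⟩ := Finset.mem_image.mp h
    obtain ⟨⟨n', k', t', b'⟩, hf, e⟩ := Finset.mem_image.mp h'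
    rw [mem_steepIndex] at hs
    rw [mem_flatIndex] at hf
    have hlt := lt_of_mem_units hf.1.1 hf.2.1
    have hk := mem_units.mp hs.2.1
    have hk' := mem_units.mp hf.2.1
    obtain ⟨e₁, e₂, -⟩ := cut_injective (by omega) (by omega) (by omega) (by omega)
      hk'.2.symm hk.2 e
    omega
  · rw [Finset.disjoint_left]
    intro ν h h'
    obtain ⟨k, -, rfl⟩ := Finset.mem_image.mp h
    rcases Finset.mem_union.mp h' with h' | h' <;>
      obtain ⟨⟨n, k, t, b⟩, h', e⟩ := Finset.mem_image.mp h'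
    · rw [mem_steepIndex, mem_units] at h'
      exact row_ne_cut (p := n) (q := k) (by omega) (by omega) e.symm
    · rw [mem_flatIndex, mem_units] at h'
      exact row_ne_cut (p := k) (q := n) (by omega) (by omega) e.symm

end TriangularPartition

theorem mainTheorem11 (l : ℕ) (hl : 2 ≤ l) :
    TriangularPartition.IsTriangular (TriangularPartition.staircaseErase l) ∧
    (TriangularPartition.inRectangle l (l - 1)).ncard =
      TriangularPartition.numSub (TriangularPartition.staircaseErase l) ∧
    ((TriangularPartition.inRectangle l (l - 1)).ncard : ℚ) =
      1 / 2 + 1 / 2 * ∑ i ∈ Finset.Icc 1 l, ((l : ℚ) - (i : ℚ) + 1) ^ 2 * (Nat.totient i : ℚ) := by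
  refine ⟨TriangularPartition.isTriangular_staircaseErase hl, ?_, ?_⟩
  · rw [TriangularPartition.numSub, TriangularPartition.inRectangle_eq hl]
  · rw [TriangularPartition.ncard_inRectangle hl]
    have h := TriangularPartition.two_mul_card_index (show 1 ≤ l by omega)
    have hc : ∑ i ∈ Finset.Icc 1 l, ((l : ℚ) - (i : ℚ) + 1) ^ 2 * (Nat.totient i : ℚ) =
        ((∑ i ∈ Finset.Icc 1 l, (l - i + 1) ^ 2 * Nat.totient i : ℕ) : ℚ) := by
      rw [Nat.cast_sum]
      refine Finset.sum_congr rfl fun i hi => ?_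
      rw [Nat.cast_mul, Nat.cast_pow, Nat.cast_add, Nat.cast_sub (Finset.mem_Icc.mp hi).2,
        Nat.cast_one]
    rw [hc]
    have h' := congrArg (Nat.cast : ℕ → ℚ) h
    rw [Nat.cast_mul, Nat.cast_add 1] at h'
    push_cast at h' ⊢
    linarith
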